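/- Let $p$ be a prime and let $K$ be a field with a nontrivial Krull valuation $v$ (written additively), with residue field $\widehat K$ and value group $v(K)$. Let $K(p)$ be the maximal $p$-extension of $K$, that is, the compositum, inside a separable closure of $K$, of all finite Galois extensions of $K$ of $p$-power degree. Let $r(p)_K$ be the rank of the profinite group $\mathrm{Gal}(K(p)/K)$, i.e. the least number of topological generators of this group, with $r(p)_K=\infty$ if it is not topologically finitely generated. Assume that $(K,v)$ is $p$-Henselian, i.e. that $v$ extends uniquely, up to equivalence, to a valuation $v_L$ of each intermediate field $L$ of $K(p)/K$. Assume also that $\widehat K$ is imperfect and $\operatorname{char}\widehat K=p$. Then $r(p)_K=\infty$. Moreover, if $\operatorname{char}K=p$ or $v(p)\in p\,v(K)$, then there is an intermediate field $\Lambda$ of $K(p)/K$ such that $[\Lambda:K]=[\widehat\Lambda:\widehat K]=p$ and $\widehat\Lambda$ is purely inseparable over $\widehat K$, where $\widehat\Lambda$ is the residue field of $(\Lambda,v_\Lambda)$. -/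

import Mathlib

/-- The rank of a profinite group `P`: the least cardinality of a set of topological generators.
It is `⊤` (that is, infinite) exactly when `P` is not topologically finitely generated.
Since finite generating sets trivially converge to `1`, no convergence condition is needed for
the `ℕ∞`-valued rank. -/
noncomputable def profiniteRank (P : Type*) [Group P] [TopologicalSpace P]
    [IsTopologicalGroup P] : ℕ∞ :=
  ⨅ (S : Set P) (_ : (Subgroup.closure S).topologicalClosure = ⊤), S.encard

/-- The maximal `p`-extension `K(p)` of `K` inside the separable closure: the compositum of
all finite Galois extensions of `K` whose degree is a power of `p`. -/
noncomputable def maximalPExtension (p : ℕ) (K : Type*) [Field K] :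
    IntermediateField K (SeparableClosure K) :=
  sSup {L | FiniteDimensional K L ∧ IsGalois K L ∧ ∃ n : ℕ, Module.finrank K L = p ^ n}

/-- `r(p)_K`: the rank of the Galois group of `K(p)/K`, with its Krull topology. -/
noncomputable def pRank (p : ℕ) (K : Type*) [Field K] : ℕ∞ :=
  profiniteRank Gal(maximalPExtension p K/K)

/-- `v` is `Ω`-Henselian: on each intermediate field `L` of `Ω/K` there is exactly one valuation
up to equivalence that extends `v`. Equivalence classes of (Krull) valuations of `L` are
identified with valuation subrings of `L`. -/
def Valuation.IsHenselianIn {K Γ₀ : Type*} [Field K] [LinearOrderedCommGroupWithZero Γ₀]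
    (v : Valuation K Γ₀) (Ω : Type*) [Field Ω] [Algebra K Ω] : Prop :=
  ∀ L : IntermediateField K Ω, ∃! w : ValuationSubring L, v.HasExtension w.valuation

/-- `v` is `p`-Henselian: it is `K(p)`-Henselian. -/
def Valuation.IsPHenselian {K Γ₀ : Type*} [Field K] [LinearOrderedCommGroupWithZero Γ₀]
    (v : Valuation K Γ₀) (p : ℕ) : Prop :=
  v.IsHenselianIn (maximalPExtension p K)

namespace Valuation

section ResidueExtension

variable {K L Γ₀ Γ₁ : Type*} [Field K] [Field L] [Algebra K L]
  [LinearOrderedCommGroupWithZero Γ₀] [LinearOrderedCommGroupWithZero Γ₁]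

/-- The residue degree is bounded by the degree of the extension. -/
theorem rank_residueField_le_finrank (v : Valuation K Γ₀) (w : Valuation L Γ₁)
    [v.HasExtension w] [FiniteDimensional K L] :
    Module.rank (IsLocalRing.ResidueField v.valuationSubring)
      (IsLocalRing.ResidueField w.valuationSubring) ≤ Module.finrank K L := by
  refine rank_le fun s hs => ?_
  choose b hb using IsLocalRing.residue_surjective (R := w.valuationSubring)
  suffices LinearIndependent K fun i : s => (b i : L) by
    simpa using this.fintype_card_le_finrank
  rw [Fintype.linearIndependent_iff]
  intro g hg
  by_contra! hne
  obtain ⟨j, hj⟩ := hne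
  obtain ⟨i, -, hi⟩ := Finset.exists_max_image Finset.univ (fun i => v (g i)) ⟨j, Finset.mem_univ j⟩
  have hi0 : g i ≠ 0 := fun h => hj <| by
    simpa [h] using hi j (Finset.mem_univ j)
  have hint (l : s) : g l / g i ∈ v.valuationSubring := by
    rw [mem_valuationSubring_iff, map_div₀]
    exact div_le_one_of_le₀ (hi l (Finset.mem_univ l)) zero_le
  have hsum : ∑ l : s, algebraMap v.valuationSubring w.valuationSubring ⟨g l / g i, hint l⟩ * b l
      = 0 := by
    apply Subtype.ext
    push_cast
    have : ∑ l : s, algebraMap K L (g i)⁻¹ * (g l • (b l : L)) = 0 := by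
      rw [← Finset.mul_sum, hg, mul_zero]
    rw [← this]
    refine Finset.sum_congr rfl fun l _ => ?_
    rw [HasExtension.coe_algebraMap_valuationSubring_eq, Algebra.smul_def]
    change algebraMap K L (g l / g i) * _ = _
    rw [div_eq_mul_inv, map_mul]
    ring
  have h0 := congrArg (IsLocalRing.residue w.valuationSubring) hsum
  rw [map_sum, map_zero] at h0
  have := Fintype.linearIndependent_iff.1 hs
    (fun l => IsLocalRing.residue v.valuationSubring ⟨g l / g i, hint l⟩) (by
      rw [← h0]
      refine Finset.sum_congr rfl fun l _ => ?_
      rw [map_mul, hb, Algebra.smul_def,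
        HasExtension.algebraMap_residue_eq_residue_algebraMap v w]) i
  have h1 : (⟨g i / g i, hint i⟩ : v.valuationSubring) = 1 := Subtype.ext (div_self hi0)
  rw [h1, map_one] at this
  exact one_ne_zero this

theorem residue_eq_iff (w : Valuation L Γ₁) {x y : w.valuationSubring} :
    IsLocalRing.residue w.valuationSubring x = IsLocalRing.residue w.valuationSubring y ↔
      w ((x : L) - y) < 1 := by
  rw [← sub_eq_zero, ← _root_.map_sub, IsLocalRing.residue_eq_zero_iff,
    Valuation.mem_maximalIdeal_iff]
  rfl

/-- An extension of prime degree `p` whose residue field contains a `p`-th root which is missing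
from the base residue field has purely inseparable residue extension of degree `p`. -/
theorem isPurelyInseparable_residueField_of_pow {p : ℕ} (hp : p.Prime) (v : Valuation K Γ₀)
    (w : Valuation L Γ₁) [v.HasExtension w]
    (hchar : CharP (IsLocalRing.ResidueField v.valuationSubring) p)
    (hrank : Module.finrank K L = p) {a : K} (ha : ∀ x : K, ¬ v (x ^ p - a) < 1)
    (ha1 : v a = 1) {θ : L} (hθ : w (θ ^ p - algebraMap K L a) < 1) :
    Module.finrank (IsLocalRing.ResidueField v.valuationSubring)
      (IsLocalRing.ResidueField w.valuationSubring) = p ∧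
    IsPurelyInseparable (IsLocalRing.ResidueField v.valuationSubring)
      (IsLocalRing.ResidueField w.valuationSubring) := by
  have : FiniteDimensional K L := .of_finrank_pos (hrank ▸ hp.pos)
  set k := IsLocalRing.ResidueField v.valuationSubring
  set l := IsLocalRing.ResidueField w.valuationSubring
  have hle := rank_residueField_le_finrank v w
  have : FiniteDimensional k l :=
    Module.rank_lt_aleph0_iff.1 (hle.trans_lt (Cardinal.natCast_lt_aleph0))
  have hle' : Module.finrank k l ≤ p := by
    rw [← Module.finrank_eq_rank] at hle
    rw [← hrank]
    exact_mod_cast hle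
  have hwa : w (algebraMap K L a) = 1 := (HasExtension.val_map_eq_one_iff v w a).2 ha1
  have hθ1 : w θ ≤ 1 := by
    have : w (θ ^ p) ≤ 1 := by
      have := w.map_add (θ ^ p - algebraMap K L a) (algebraMap K L a)
      rw [sub_add_cancel] at this
      exact this.trans (max_le hθ.le hwa.le)
    rwa [map_pow, pow_le_one_iff hp.ne_zero] at this
  let a' : k := IsLocalRing.residue _ ⟨a, ha1.le⟩
  let t : l := IsLocalRing.residue _ ⟨θ, hθ1⟩
  have ht : t ^ p = algebraMap k l a' := by
    rw [HasExtension.algebraMap_residue_eq_residue_algebraMap v w, ← map_pow, residue_eq_iff]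
    exact hθ
  have ha' (x : k) : x ^ p ≠ a' := by
    obtain ⟨y, rfl⟩ := IsLocalRing.residue_surjective x
    rw [← map_pow, Ne, residue_eq_iff]
    exact ha y
  have hirr := X_pow_sub_C_irreducible_of_prime hp ha'
  have hmin : minpoly k t = Polynomial.X ^ p - Polynomial.C a' :=
    (minpoly.eq_of_irreducible_of_monic hirr (by simp [ht])
      (Polynomial.monic_X_pow_sub_C _ hp.ne_zero)).symm
  have hdeg : Module.finrank k (IntermediateField.adjoin k {t}) = p := by
    rw [IntermediateField.adjoin.finrank (Algebra.IsIntegral.isIntegral t), hmin,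
      Polynomial.natDegree_X_pow_sub_C]
  have htop : IntermediateField.adjoin k {t} = ⊤ := by
    apply IntermediateField.eq_of_le_of_finrank_le le_top
    rw [IntermediateField.finrank_top', hdeg]
    exact hle'
  refine ⟨by rw [← hdeg, htop, IntermediateField.finrank_top'], ?_⟩
  have : ExpChar k p := .prime hp
  have h1 : IsPurelyInseparable k (IntermediateField.adjoin k {t}) :=
    (IntermediateField.isPurelyInseparable_adjoin_simple_iff_pow_mem k l p).2
      ⟨1, a', by rw [pow_one, ht]⟩
  rw [htop] at h1
  exact IntermediateField.topEquiv.isPurelyInseparable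

end ResidueExtension

section Basic

variable {K Γ₀ : Type*} [Field K] [LinearOrderedCommGroupWithZero Γ₀] (v : Valuation K Γ₀)

theorem exists_not_pow_residue {p : ℕ} (hp : p.Prime)
    (hchar : CharP (IsLocalRing.ResidueField v.valuationSubring) p)
    (himp : ¬ PerfectField (IsLocalRing.ResidueField v.valuationSubring)) :
    ∃ a : K, v a = 1 ∧ ∀ x : K, ¬ v (x ^ p - a) < 1 := by
  set k := IsLocalRing.ResidueField v.valuationSubring
  have : Fact p.Prime := ⟨hp⟩
  have : ExpChar k p := .prime hp
  have hsurj : ¬ Function.Surjective (frobenius k p) := fun h => himp <| by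
    have := PerfectRing.ofSurjective k p h
    exact PerfectRing.toPerfectField k p
  simp only [Function.Surjective, not_forall, not_exists] at hsurj
  obtain ⟨b, hb⟩ := hsurj
  obtain ⟨a, rfl⟩ := IsLocalRing.residue_surjective b
  have key (x : K) : ¬ v (x ^ p - a) < 1 := fun h => by
    have hx : v (x ^ p) ≤ 1 := by
      have := v.map_add (x ^ p - a) a
      rw [sub_add_cancel] at this
      exact this.trans (max_le h.le a.2)
    rw [map_pow, pow_le_one_iff hp.ne_zero] at hx
    refine hb (IsLocalRing.residue _ ⟨x, hx⟩) ?_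
    rw [frobenius_def, ← map_pow, residue_eq_iff]
    exact h
  refine ⟨a, le_antisymm a.2 (not_lt.1 fun h => key 0 ?_), key⟩
  rwa [zero_pow hp.ne_zero, zero_sub, map_neg]

theorem natCast_lt_one_of_charP_residueField {p : ℕ}
    (hchar : CharP (IsLocalRing.ResidueField v.valuationSubring) p) : v (p : K) < 1 := by
  have h : IsLocalRing.residue v.valuationSubring (p : v.valuationSubring) =
      IsLocalRing.residue v.valuationSubring 0 := by simp
  rw [residue_eq_iff] at h
  simpa using h

theorem infinite_residueField (himp : ¬ PerfectField (IsLocalRing.ResidueField v.valuationSubring)) :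
    Infinite (IsLocalRing.ResidueField v.valuationSubring) := by
  by_contra h
  rw [not_infinite_iff_finite] at h
  exact himp inferInstance

theorem exists_hasExtension {Ω : Type*} [Field Ω] [Algebra K Ω] :
    ∃ A : ValuationSubring Ω, v.HasExtension A.valuation := by
  obtain ⟨A, h, hloc⟩ := IsLocalRing.exists_factor_valuationRing
    ((algebraMap K Ω).comp v.valuationSubring.subtype)
  refine ⟨A, HasExtension.ofComapInteger ?_⟩
  ext x
  simp only [Subring.mem_comap, mem_integer_iff, ValuationSubring.valuation_le_one_iff]
  refine ⟨fun hx => ?_, fun hx => h ⟨x, hx⟩⟩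
  by_contra hlt
  rw [not_le] at hlt
  have hx0 : x ≠ 0 := by rintro rfl; simp at hlt
  have hinv : v x⁻¹ < 1 := by rw [map_inv₀]; exact inv_lt_one_of_one_lt₀ hlt
  have hu : IsUnit (⟨x⁻¹, hinv.le⟩ : v.valuationSubring) := by
    apply hloc.map_nonunit
    refine .of_mul_eq_one ⟨algebraMap K Ω x, hx⟩ (Subtype.ext ?_)
    change algebraMap K Ω x⁻¹ * algebraMap K Ω x = 1
    rw [← map_mul, inv_mul_cancel₀ hx0, map_one]
  have := (Valuation.mem_maximalIdeal_iff (v := v) (a := ⟨x⁻¹, hinv.le⟩)).2 hinv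
  exact this hu

end Basic

end Valuation

section GaloisHom

variable {K : Type*} [Field K] {A : Type*} [Group A]

theorem fixingSubgroup_fixedField_ker (T : Gal(SeparableClosure K/K) →* A)
    (hT : IsOpen (T.ker : Set Gal(SeparableClosure K/K))) :
    (IntermediateField.fixedField T.ker).fixingSubgroup = T.ker :=
  InfiniteGalois.fixingSubgroup_fixedField ⟨T.ker, T.ker.isClosed_of_isOpen hT⟩

theorem finite_and_isGalois_fixedField_ker (T : Gal(SeparableClosure K/K) →* A)
    (hT : IsOpen (T.ker : Set Gal(SeparableClosure K/K))) :
    FiniteDimensional K (IntermediateField.fixedField T.ker) ∧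
      IsGalois K (IntermediateField.fixedField T.ker) := by
  rw [← InfiniteGalois.isOpen_and_normal_iff_finite_and_isGalois,
    fixingSubgroup_fixedField_ker T hT]
  exact ⟨hT, inferInstance⟩

theorem finrank_fixedField_ker (T : Gal(SeparableClosure K/K) →* A)
    (hT : IsOpen (T.ker : Set Gal(SeparableClosure K/K))) :
    Module.finrank K (IntermediateField.fixedField T.ker) = Nat.card T.range := by
  obtain ⟨h1, h2⟩ := finite_and_isGalois_fixedField_ker T hT
  let H : ClosedSubgroup Gal(SeparableClosure K/K) := ⟨T.ker, T.ker.isClosed_of_isOpen hT⟩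
  have : H.Normal := inferInstanceAs T.ker.Normal
  rw [← IsGalois.card_aut_eq_finrank,
    ← Nat.card_congr (QuotientGroup.quotientKerEquivRange T).toEquiv]
  exact (Nat.card_congr (InfiniteGalois.normalAutEquivQuotient H).toEquiv).symm

theorem fixedField_ker_le_maximalPExtension {p : ℕ} (hp : p.Prime) (hA : Nat.card A = p)
    (T : Gal(SeparableClosure K/K) →* A)
    (hT : IsOpen (T.ker : Set Gal(SeparableClosure K/K))) :
    IntermediateField.fixedField T.ker ≤ maximalPExtension p K := by
  obtain ⟨h1, h2⟩ := finite_and_isGalois_fixedField_ker T hT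
  refine le_sSup ⟨h1, h2, ?_⟩
  rw [finrank_fixedField_ker T hT]
  have hdvd : Nat.card T.range ∣ p ^ 1 := by
    rw [pow_one, ← hA]
    exact T.range.card_subgroup_dvd_card
  obtain ⟨n, -, hn⟩ := (Nat.dvd_prime_pow hp).1 hdvd
  exact ⟨n, hn⟩

instance normal_maximalPExtension (p : ℕ) : Normal K (maximalPExtension p K) := by
  unfold maximalPExtension
  rw [sSup_eq_iSup']
  have (L : {L : IntermediateField K (SeparableClosure K) |
      FiniteDimensional K L ∧ IsGalois K L ∧ ∃ n : ℕ, Module.finrank K L = p ^ n}) :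
      Normal K (L : IntermediateField K (SeparableClosure K)) :=
    have := L.2.2.1
    inferInstance
  exact IntermediateField.normal_iSup K (SeparableClosure K) _

instance isGalois_maximalPExtension (p : ℕ) : IsGalois K (maximalPExtension p K) where

theorem eq_of_eqOn_generators {p : ℕ} (hp : p.Prime) (hA : Nat.card A = p)
    {S : Set Gal(maximalPExtension p K/K)} (hS : (Subgroup.closure S).topologicalClosure = ⊤)
    {T T' : Gal(SeparableClosure K/K) →* A}
    (hT : IsOpen (T.ker : Set Gal(SeparableClosure K/K)))
    (hT' : IsOpen (T'.ker : Set Gal(SeparableClosure K/K)))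
    (heq : ∀ s ∈ S, ∃ g, AlgEquiv.restrictNormalHom (maximalPExtension p K) g = s ∧ T g = T' g) :
    T = T' := by
  set M := maximalPExtension p K
  let H : Subgroup Gal(SeparableClosure K/K) := T.eqLocus T'
  have hker : T.ker ⊓ T'.ker ≤ H := fun g hg => by
    obtain ⟨h1, h2⟩ := Subgroup.mem_inf.1 hg
    exact (MonoidHom.mem_ker.1 h1).trans (MonoidHom.mem_ker.1 h2).symm
  have hHo : IsOpen (H : Set Gal(SeparableClosure K/K)) :=
    Subgroup.isOpen_mono hker (hT.inter hT')
  have hHfix : (IntermediateField.fixedField H).fixingSubgroup = H :=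
    InfiniteGalois.fixingSubgroup_fixedField ⟨H, H.isClosed_of_isOpen hHo⟩
  have hMH : M.fixingSubgroup ≤ H := by
    refine le_trans (le_inf ?_ ?_) hker
    · rw [← fixingSubgroup_fixedField_ker T hT]
      exact IntermediateField.fixingSubgroup_antitone
        (fixedField_ker_le_maximalPExtension hp hA T hT)
    · rw [← fixingSubgroup_fixedField_ker T' hT']
      exact IntermediateField.fixingSubgroup_antitone
        (fixedField_ker_le_maximalPExtension hp hA T' hT')
  have hFM : IntermediateField.fixedField H ≤ M := by
    rw [← InfiniteGalois.fixedField_fixingSubgroup M]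
    exact IntermediateField.fixedField_antitone hMH
  let F : IntermediateField K M := IntermediateField.restrict hFM
  have hFtop : F.fixingSubgroup = ⊤ := by
    rw [eq_top_iff, ← hS]
    refine Subgroup.topologicalClosure_minimal _ ?_ (InfiniteGalois.fixingSubgroup_isClosed F)
    rw [Subgroup.closure_le]
    intro s hs
    obtain ⟨g, rfl, hg⟩ := heq s hs
    rw [SetLike.mem_coe, IntermediateField.mem_fixingSubgroup_iff]
    intro x hx
    apply Subtype.ext
    have hx' : (x : SeparableClosure K) ∈ IntermediateField.fixedField H :=
      (IntermediateField.mem_restrict hFM x).1 hx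
    exact (AlgEquiv.restrictNormal_commutes g M x).trans (hx' ⟨g, hg⟩)
  have hFbot : F = ⊥ := by
    rw [← InfiniteGalois.fixedField_fixingSubgroup F, hFtop]
    exact InfiniteGalois.fixedField_bot
  have hbot : IntermediateField.fixedField H = ⊥ := by
    rw [eq_bot_iff]
    intro x hx
    have : (⟨x, hFM hx⟩ : M) ∈ F := (IntermediateField.mem_restrict hFM _).2 hx
    rw [hFbot, IntermediateField.mem_bot] at this
    obtain ⟨y, hy⟩ := this
    rw [IntermediateField.mem_bot]
    exact ⟨y, congrArg Subtype.val hy⟩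
  have hHtop : H = ⊤ := by
    rw [← hHfix, hbot, IntermediateField.fixingSubgroup_bot]
  ext g
  have hg : g ∈ H := hHtop ▸ Subgroup.mem_top g
  exact hg

/-- If `r(p)_K` is finite then there are only finitely many continuous homomorphisms from the
absolute Galois group to a given group of order `p`. -/
theorem finite_hom_of_pRank_ne_top {p : ℕ} (hp : p.Prime) (hA : Nat.card A = p)
    (h : pRank p K ≠ ⊤) :
    {T : Gal(SeparableClosure K/K) →* A |
      IsOpen (T.ker : Set Gal(SeparableClosure K/K))}.Finite := by
  have : ∃ S : Set Gal(maximalPExtension p K/K),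
      (Subgroup.closure S).topologicalClosure = ⊤ ∧ S.Finite := by
    by_contra! hcon
    refine h ?_
    rw [pRank, profiniteRank]
    simp only [iInf_eq_top]
    exact fun S hS => Set.encard_eq_top_iff.2 (hcon S hS)
  obtain ⟨S, hS, hfin⟩ := this
  have := hfin.to_subtype
  have := Nat.finite_of_card_ne_zero (hA ▸ hp.ne_zero)
  choose lift hlift using AlgEquiv.restrictNormalHom_surjective (F := K)
    (K₁ := maximalPExtension p K) (SeparableClosure K)
  refine Set.Finite.of_injOn (f := fun T (s : S) => T (lift s)) (fun _ _ => Set.mem_univ _) ?_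
    (Set.finite_univ (α := S → A))
  intro T hT T' hT' heq
  exact eq_of_eqOn_generators hp hA hS hT hT' fun s hs =>
    ⟨lift s, hlift s, congrFun heq ⟨s, hs⟩⟩

theorem pRank_eq_top_of_injective {p : ℕ} (hp : p.Prime) (hA : Nat.card A = p)
    {ι : Type*} [Infinite ι] (T : ι → Gal(SeparableClosure K/K) →* A)
    (hT : ∀ i, IsOpen ((T i).ker : Set Gal(SeparableClosure K/K))) (hinj : Function.Injective T) :
    pRank p K = ⊤ := by
  by_contra h
  exact Set.infinite_of_injective_forall_mem hinj hT (finite_hom_of_pRank_ne_top hp hA h)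

end GaloisHom

theorem ValuationSubring.isEquiv_valuation_comap {L Ω : Type*} [Field L] [Field Ω]
    (U : ValuationSubring Ω) (f : L →+* Ω) :
    (U.comap f).valuation.IsEquiv (U.valuation.comap f) := by
  rw [Valuation.isEquiv_iff_val_le_one]
  intro x
  rw [ValuationSubring.valuation_le_one_iff, Valuation.comap_apply,
    ValuationSubring.valuation_le_one_iff, ValuationSubring.mem_comap]

section Fierce

variable {K Γ₀ : Type*} [Field K] [LinearOrderedCommGroupWithZero Γ₀]
  {A : Type*} [Group A]

/-- If an element of the cyclic degree-`p` extension cut out by `T` has residue a `p`-th root that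
is missing from the residue field of `K`, then the residue extension is purely inseparable of
degree `p`. -/
theorem exists_purelyInseparable_of_hom {v : Valuation K Γ₀} {p : ℕ} (hp : p.Prime)
    (hchar : CharP (IsLocalRing.ResidueField v.valuationSubring) p) (hA : Nat.card A = p)
    (T : Gal(SeparableClosure K/K) →* A)
    (hT : IsOpen (T.ker : Set Gal(SeparableClosure K/K)))
    (U : ValuationSubring (SeparableClosure K)) [hU : v.HasExtension U.valuation]
    {a : K} (ha : ∀ x : K, ¬ v (x ^ p - a) < 1) (ha1 : v a = 1) {θ : SeparableClosure K}
    (hfix : ∀ g ∈ T.ker, g θ = θ)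
    (hθ : U.valuation (θ ^ p - algebraMap K _ a) < 1) :
    ∃ (Λ : IntermediateField K (maximalPExtension p K)) (w : ValuationSubring Λ)
          (_ : v.HasExtension w.valuation),
          Module.finrank K Λ = p ∧
          Module.finrank (IsLocalRing.ResidueField v.valuationSubring)
            (IsLocalRing.ResidueField w.valuation.valuationSubring) = p ∧
          IsPurelyInseparable (IsLocalRing.ResidueField v.valuationSubring)
            (IsLocalRing.ResidueField w.valuation.valuationSubring) := by
  have hle := fixedField_ker_le_maximalPExtension hp hA T hT
  have hθL : θ ∈ IntermediateField.fixedField T.ker := fun g => hfix g g.2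
  have hdvd : Nat.card T.range ∣ p := hA ▸ T.range.card_subgroup_dvd_card
  have hdeg : Nat.card T.range = p := by
    refine ((Nat.dvd_prime hp).1 hdvd).resolve_left fun h1 => ?_
    rw [← finrank_fixedField_ker T hT, IntermediateField.finrank_eq_one_iff] at h1
    rw [h1, IntermediateField.mem_bot] at hθL
    obtain ⟨x, rfl⟩ := hθL
    rw [← map_pow, ← map_sub, Valuation.HasExtension.val_map_lt_one_iff v] at hθ
    exact ha x hθ
  let Λ : IntermediateField K (maximalPExtension p K) := IntermediateField.restrict hle
  let f : Λ →+* SeparableClosure K := (algebraMap (maximalPExtension p K) _).comp (algebraMap Λ _)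
  have hf : f.comp (algebraMap K Λ) = algebraMap K (SeparableClosure K) := rfl
  let w : ValuationSubring Λ := U.comap f
  have hw := U.isEquiv_valuation_comap f
  have hext : v.HasExtension w.valuation := ⟨by
    refine hU.val_isEquiv_comap.trans ?_
    rw [← hf]
    exact (hw.comap (algebraMap K Λ)).symm⟩
  have hrank : Module.finrank K Λ = p := by
    refine Eq.trans ?_ hdeg
    rw [← finrank_fixedField_ker T hT]
    exact (IntermediateField.restrictAlgEquiv hle).toLinearEquiv.finrank_eq.symm
  refine ⟨Λ, w, hext, hrank, ?_⟩
  refine Valuation.isPurelyInseparable_residueField_of_pow hp v w.valuation hchar hrank ha ha1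
    (θ := ⟨⟨θ, hle hθL⟩, (IntermediateField.mem_restrict hle _).2 hθL⟩) ?_
  rw [hw.lt_one_iff_lt_one]
  exact hθ

end Fierce

section ArtinSchreier

variable {K Γ₀ : Type*} [Field K] [LinearOrderedCommGroupWithZero Γ₀] (p : ℕ) [hp : Fact p.Prime]

/-- The Artin–Schreier character attached to `a`. -/
theorem exists_artinSchreier_hom [CharP K p] (a : K) :
    ∃ (T : Gal(SeparableClosure K/K) →* Multiplicative (ZMod p)) (y : SeparableClosure K),
      IsOpen (T.ker : Set Gal(SeparableClosure K/K)) ∧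
      y ^ p - y = algebraMap K _ a ∧
      haveI : CharP (SeparableClosure K) p := charP_of_injective_algebraMap' K p
      ∀ g, g y = y + ZMod.castHom dvd_rfl (SeparableClosure K) (T g).toAdd := by
  have : CharP (SeparableClosure K) p := charP_of_injective_algebraMap' K p
  obtain ⟨y, hy⟩ := IsSepClosed.exists_root_C_mul_X_pow_add_C_mul_X_add_C'
    (k := SeparableClosure K) p p 1 (-1) (-algebraMap K _ a) dvd_rfl hp.1.two_le (by simp)
  have hy' : y ^ p - y = algebraMap K _ a := by linear_combination hy
  let c := ZMod.castHom (dvd_refl p) (SeparableClosure K)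
  have hc : Function.Injective c := c.injective
  have key (g : Gal(SeparableClosure K/K)) : ∃ n : ZMod p, g y = y + c n := by
    have h1 : (g y - y) ^ p = g y - y := by
      have h2 := congrArg g hy'
      rw [map_sub, map_pow, AlgEquiv.commutes, ← hy'] at h2
      rw [sub_pow_char]
      linear_combination h2
    rw [← Subfield.mem_bot_iff_pow_eq_self (SeparableClosure K) p,
      ← ZMod.fieldRange_castHom_eq_bot p] at h1
    obtain ⟨n, hn⟩ := h1
    exact ⟨n, by linear_combination -hn⟩
  choose n hn using key
  let T : Gal(SeparableClosure K/K) →* Multiplicative (ZMod p) :=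
    MonoidHom.mk' (fun g => Multiplicative.ofAdd (n g)) fun g h => by
      rw [← ofAdd_add]
      congr 1
      apply hc
      have h1 := hn (g * h)
      rw [AlgEquiv.mul_apply, hn h, map_add, hn g] at h1
      have h2 : g (c (n h)) = c (n h) := by
        rw [← ZMod.natCast_zmod_val (n h), map_natCast, map_natCast]
      rw [h2] at h1
      rw [map_add]
      linear_combination -h1
  refine ⟨T, y, ?_, hy', hn⟩
  refine Subgroup.isOpen_mono ?_ (stabilizer_isOpen_of_isIntegral (K := K) y)
  intro g hg
  have hg' : g y = y := hg
  rw [MonoidHom.mem_ker]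
  change Multiplicative.ofAdd (n g) = 1
  rw [ofAdd_eq_one]
  apply hc
  rw [map_zero]
  have := hn g
  rw [hg'] at this
  linear_combination -this

variable {p}

/-- If `y ^ p - y = a / π ^ p` with `v π < 1` and `v a ≤ 1`, then the residue of `π y` is
the `p`-th root of the residue of `a`. -/
theorem Valuation.artinSchreier_residue {L Γ : Type*} [Field L] [LinearOrderedCommGroupWithZero Γ]
    (w : Valuation L Γ) {a π y : L} (ha : w a ≤ 1) (hπ0 : π ≠ 0) (hπ : w π < 1)
    (h : y ^ p - y = a / π ^ p) : w ((π * y) ^ p - a) < 1 := by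
  have hp2 := hp.1.two_le
  obtain ⟨q, rfl⟩ : ∃ q, p = q + 2 := ⟨p - 2, by omega⟩
  have h1 : (π * y) ^ (q + 2) - a = π ^ (q + 1) * (π * y) := by
    field_simp at h
    linear_combination h
  have hπ' : w (π ^ (q + 1)) < 1 := by
    rw [map_pow]
    exact pow_lt_one₀ zero_le hπ (Nat.succ_ne_zero q)
  have hint : w (π * y) ≤ 1 := by
    by_contra! hlt
    have h2 : w ((π * y) ^ (q + 2)) ≤ max (w (π * y)) 1 := by
      rw [show (π * y) ^ (q + 2) = π ^ (q + 1) * (π * y) + a by linear_combination h1]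
      refine (w.map_add _ _).trans (max_le_max ?_ ha)
      rw [map_mul]
      exact mul_le_of_le_one_left zero_le hπ'.le
    rw [max_eq_left hlt.le, map_pow, pow_succ] at h2
    have h3 : (1 : Γ) < w (π * y) ^ (q + 1) := one_lt_pow₀ hlt (Nat.succ_ne_zero q)
    have h4 := mul_lt_mul_of_pos_right h3 (zero_lt_one.trans hlt)
    rw [one_mul] at h4
    exact absurd h2 (not_le.2 h4)
  rw [h1, map_mul]
  exact mul_lt_one_of_lt_of_le hπ' hint

variable {v : Valuation K Γ₀}

theorem pRank_eq_top_of_charP [CharP K p] (hv : v.IsNontrivial)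
    {a : K} (ha : ∀ x : K, ¬ v (x ^ p - a) < 1) (ha1 : v a = 1) : pRank p K = ⊤ := by
  obtain ⟨π, hπ0, hπ⟩ := hv.exists_lt_one
  have hπ0' : π ≠ 0 := by simpa using hπ0
  choose T y hT hy hTy using fun i : ℕ => exists_artinSchreier_hom p (a / (π ^ (i + 1)) ^ p)
  refine pRank_eq_top_of_injective hp.1 (A := Multiplicative (ZMod p)) (by simp) T hT ?_
  refine Function.Injective.of_lt_imp_ne fun i j hij heq => ?_
  have hfix : ∀ g : Gal(SeparableClosure K/K), g (y j - y i) = y j - y i := fun g => by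
    rw [map_sub, hTy, hTy, heq]
    ring
  obtain ⟨z, hz⟩ := (InfiniteGalois.mem_range_algebraMap_iff_fixed _).2 hfix
  have hz' : z ^ p - z = a / (π ^ (j + 1)) ^ p - a / (π ^ (i + 1)) ^ p := by
    apply (algebraMap K (SeparableClosure K)).injective
    have : CharP (SeparableClosure K) p := charP_of_injective_algebraMap' K p
    rw [map_sub, map_sub, map_pow, hz, ← hy, ← hy, sub_pow_char]
    ring
  obtain ⟨d, rfl⟩ := Nat.exists_eq_add_of_lt hij
  have hd : v (a * (π ^ (d + 1)) ^ p) < 1 := by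
    rw [map_mul, ha1, one_mul, map_pow, map_pow]
    exact pow_lt_one₀ zero_le (pow_lt_one₀ zero_le hπ (Nat.succ_ne_zero _)) hp.1.ne_zero
  have hz2 : z ^ p - z = (a - a * (π ^ (d + 1)) ^ p) / (π ^ (i + d + 1 + 1)) ^ p := by
    rw [hz', show i + d + 1 + 1 = (i + 1) + (d + 1) by ring, pow_add, mul_pow]
    field_simp
  have h1 := v.artinSchreier_residue (p := p)
    ((v.map_sub a _).trans (max_le ha1.le hd.le)) (pow_ne_zero _ hπ0')
    (by rw [map_pow]; exact pow_lt_one₀ zero_le hπ (Nat.succ_ne_zero _)) hz2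
  refine ha (π ^ (i + d + 1 + 1) * z) ?_
  refine lt_of_eq_of_lt (congrArg v ?_) ((v.map_sub _ _).trans_lt (max_lt h1 hd))
  ring

theorem exists_purelyInseparable_of_charP [CharP K p] (hv : v.IsNontrivial)
    (hchar : CharP (IsLocalRing.ResidueField v.valuationSubring) p)
    {a : K} (ha : ∀ x : K, ¬ v (x ^ p - a) < 1) (ha1 : v a = 1) :
    ∃ (Λ : IntermediateField K (maximalPExtension p K)) (w : ValuationSubring Λ)
          (_ : v.HasExtension w.valuation),
          Module.finrank K Λ = p ∧
          Module.finrank (IsLocalRing.ResidueField v.valuationSubring)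
            (IsLocalRing.ResidueField w.valuation.valuationSubring) = p ∧
          IsPurelyInseparable (IsLocalRing.ResidueField v.valuationSubring)
            (IsLocalRing.ResidueField w.valuation.valuationSubring) := by
  obtain ⟨π, hπ0, hπ⟩ := hv.exists_lt_one
  have hπ0' : π ≠ 0 := by simpa using hπ0
  obtain ⟨T, y, hT, hy, hTy⟩ := exists_artinSchreier_hom p (a / π ^ p)
  obtain ⟨U, hU⟩ := v.exists_hasExtension (Ω := SeparableClosure K)
  refine exists_purelyInseparable_of_hom hp.1 hchar (A := Multiplicative (ZMod p)) (by simp) T hT U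
    ha ha1 (θ := algebraMap K _ π * y) (fun g hg => ?_) ?_
  · rw [map_mul, AlgEquiv.commutes, hTy, MonoidHom.mem_ker.1 hg, toAdd_one, map_zero, add_zero]
  · refine U.valuation.artinSchreier_residue ?_ (by simpa using hπ0') ?_ (by simpa using hy)
    · exact (Valuation.HasExtension.val_map_le_one_iff v _ a).2 ha1.le
    · exact (Valuation.HasExtension.val_map_lt_one_iff v _ π).2 hπ

end ArtinSchreier

theorem exists_one_add_pow_prime_eq {R : Type*} [CommRing R] {p : ℕ} (hp : p.Prime) (x : R) :
    ∃ s, (x + 1) ^ p = x ^ p + 1 + p * (x + x ^ 2 * s) := by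
  have h1 : Finset.Ioo 0 p = insert 1 (Finset.Ioo 1 p) := by
    ext k
    have := hp.two_le
    simp only [Finset.mem_Ioo, Finset.mem_insert]
    omega
  have hdvd : x ∣ ∑ k ∈ Finset.Ioo 1 p,
      x ^ (k - 1) * 1 ^ (p - k - 1) * ((p.choose k / p : ℕ) : R) :=
    Finset.dvd_sum fun k hk => by
      rw [mul_assoc]
      exact (dvd_pow_self x (Nat.sub_ne_zero_of_lt (Finset.mem_Ioo.1 hk).1)).mul_right _
  obtain ⟨s, hs⟩ := hdvd
  refine ⟨s, ?_⟩
  rw [add_pow_prime_eq hp, h1, Finset.sum_insert (by simp), hs, Nat.choose_one_right,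
    Nat.div_self hp.pos]
  simp
  ring

namespace Valuation

variable {L Γ : Type*} [Field L] [LinearOrderedCommGroupWithZero Γ] (u : Valuation L Γ)

theorem map_natCast_le_one (n : ℕ) : u n ≤ 1 := (natCast_mem u.integer n)

theorem map_natCast_eq_one_of_coprime {p n : ℕ} (hup : u p < 1) (h : n.Coprime p) : u n = 1 := by
  refine le_antisymm (u.map_natCast_le_one n) (not_lt.1 fun hn => ?_)
  have hbez : ((n * n.gcdA p + p * n.gcdB p : ℤ) : L) = 1 := by
    rw [← Nat.gcd_eq_gcd_ab, Nat.Coprime.gcd_eq_one h]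
    simp
  push_cast at hbez
  have hint (m : ℤ) : u m ≤ 1 := intCast_mem u.integer m
  have : u (1 : L) < 1 := by
    rw [← hbez]
    refine u.map_add_lt ?_ ?_ <;> rw [map_mul]
    · exact mul_lt_one_of_lt_of_le hn (hint _)
    · exact mul_lt_one_of_lt_of_le hup (hint _)
  exact this.ne (map_one u)

theorem map_eq_of_sub_lt_one {x y : L} (hy : u y = 1) (h : u (x - y) < 1) : u x = 1 := by
  have := u.map_add_eq_of_lt_right (x := x - y) (y := y) (by rwa [hy])
  rwa [sub_add_cancel, hy] at this

theorem map_le_one_of_sub_lt_one {x y : L} (hy : u y ≤ 1) (h : u (x - y) < 1) : u x ≤ 1 := by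
  have := u.map_add (x - y) y
  rw [sub_add_cancel] at this
  exact this.trans (max_le h.le hy)

theorem map_sub_pow_lt_one {x y : L} (hx : u x ≤ 1) (hy : u y ≤ 1) (h : u (x - y) < 1) (n : ℕ) :
    u (x ^ n - y ^ n) < 1 := by
  obtain ⟨c, hc⟩ := sub_dvd_pow_sub_pow (⟨x, hx⟩ : u.integer) ⟨y, hy⟩ n
  have hc' : x ^ n - y ^ n = (x - y) * c := congrArg Subtype.val hc
  rw [hc', map_mul]
  exact mul_lt_one_of_lt_of_le h c.2

theorem map_sub_pow_prime_sub_lt_one {p : ℕ} (hp : p.Prime) (hup : u p < 1) {x y : L}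
    (hx : u x ≤ 1) (hy : u y ≤ 1) : u ((x - y) ^ p - (x ^ p - y ^ p)) < 1 := by
  obtain ⟨r, hr⟩ := exists_add_pow_prime_eq hp
    ((⟨x, hx⟩ : u.integer) - ⟨y, hy⟩) (⟨y, hy⟩ : u.integer)
  rw [sub_add_cancel] at hr
  have hr' : x ^ p = (x - y) ^ p + y ^ p + p * (x - y) * y * r := congrArg Subtype.val hr
  rw [show (x - y) ^ p - (x ^ p - y ^ p) = -(p * ((x - y) * y * r)) by rw [hr']; ring,
    map_neg, map_mul]
  refine mul_lt_one_of_lt_of_le hup ?_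
  exact ((⟨x, hx⟩ - ⟨y, hy⟩) * ⟨y, hy⟩ * r : u.integer).2

theorem map_sub_lt_one_of_pow_prime {p : ℕ} (hp : p.Prime) (hup : u p < 1) {x y : L}
    (hx : u x ≤ 1) (hy : u y ≤ 1) (h : u (x ^ p - y ^ p) < 1) : u (x - y) < 1 := by
  have h1 : u ((x - y) ^ p) < 1 := by
    rw [← sub_add_cancel ((x - y) ^ p) (x ^ p - y ^ p)]
    exact u.map_add_lt (u.map_sub_pow_prime_sub_lt_one hp hup hx hy) h
  rwa [map_pow, pow_lt_one_iff hp.ne_zero] at h1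

/-- `x` is congruent to `1 + l a` modulo terms of valuation smaller than that of `l`,
where `a` is integral. -/
def FirstOrder (l x a : L) : Prop := u a ≤ 1 ∧ u (x - (1 + l * a)) < u l

namespace FirstOrder

variable {u} {l x y a b : L}

theorem one (hl0 : l ≠ 0) : u.FirstOrder l 1 0 := by
  refine ⟨by simp, ?_⟩
  simpa using (zero_lt_iff.2 (u.ne_zero_iff.2 hl0))

theorem sub_one_lt (hl : u l < 1) (h : u.FirstOrder l x a) : u (x - 1) < 1 := by
  rw [show x - 1 = (x - (1 + l * a)) + l * a by ring]
  refine u.map_add_lt (h.2.trans hl) ?_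
  rw [map_mul]
  exact mul_lt_one_of_lt_of_le hl h.1

theorem map_eq_one (hl : u l < 1) (h : u.FirstOrder l x a) : u x = 1 :=
  u.map_eq_of_sub_lt_one (map_one u) (h.sub_one_lt hl)

theorem congr (h : u.FirstOrder l x a) (hab : u (b - a) < 1) : u.FirstOrder l x b := by
  refine ⟨u.map_le_one_of_sub_lt_one h.1 hab, ?_⟩
  rw [show x - (1 + l * b) = (x - (1 + l * a)) - l * (b - a) by ring]
  refine (u.map_sub _ _).trans_lt (max_lt h.2 ?_)
  rw [map_mul]
  have : u l ≠ 0 := (zero_le.trans_lt h.2).ne'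
  exact mul_lt_of_lt_one_right (zero_lt_iff.2 this) hab

theorem mul (hl : u l < 1) (hx : u.FirstOrder l x a) (hy : u.FirstOrder l y b) :
    u.FirstOrder l (x * y) (a + b) := by
  have hl0 : 0 < u l := zero_le.trans_lt hx.2
  refine ⟨(u.map_add _ _).trans (max_le hx.1 hy.1), ?_⟩
  have hA : u (1 + l * a) ≤ 1 := by
    refine (u.map_add _ _).trans (max_le (map_one u).le ?_)
    rw [map_mul]
    exact mul_le_one₀ hl.le zero_le hx.1
  rw [show x * y - (1 + l * (a + b)) =
    (x - (1 + l * a)) * y + (1 + l * a) * (y - (1 + l * b)) + l * (l * (a * b)) by ring]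
  refine u.map_add_lt (u.map_add_lt ?_ ?_) ?_
  · rw [map_mul, hy.map_eq_one hl, mul_one]
    exact hx.2
  · rw [map_mul]
    exact (mul_le_of_le_one_left zero_le hA).trans_lt hy.2
  · rw [map_mul]
    refine mul_lt_of_lt_one_right hl0 ?_
    rw [map_mul, map_mul]
    exact mul_lt_one_of_lt_of_le hl (mul_le_one₀ hx.1 zero_le hy.1)

theorem inv (hl : u l < 1) (hx : u.FirstOrder l x a) : u.FirstOrder l x⁻¹ (-a) := by
  have hl0 : 0 < u l := zero_le.trans_lt hx.2
  have hx1 := hx.map_eq_one hl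
  have hx0 : x ≠ 0 := by rintro rfl; simp at hx1
  refine ⟨by rw [map_neg]; exact hx.1, ?_⟩
  rw [show x⁻¹ - (1 + l * -a) = x⁻¹ * (l * (l * a ^ 2) - (x - (1 + l * a)) * (1 - l * a)) by
    field_simp; ring, map_mul, map_inv₀, hx1, inv_one, one_mul]
  refine (u.map_sub _ _).trans_lt (max_lt ?_ ?_)
  · rw [map_mul]
    refine mul_lt_of_lt_one_right hl0 ?_
    rw [map_mul, map_pow]
    exact mul_lt_one_of_lt_of_le hl (pow_le_one₀ zero_le hx.1)
  · rw [map_mul]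
    refine (mul_le_of_le_one_right zero_le ?_).trans_lt hx.2
    refine (u.map_sub _ _).trans (max_le (map_one u).le ?_)
    rw [map_mul]
    exact mul_le_one₀ hl.le zero_le hx.1

theorem div (hl : u l < 1) (hx : u.FirstOrder l x a) (hy : u.FirstOrder l y b) :
    u.FirstOrder l (x / y) (a - b) := by
  rw [div_eq_mul_inv, sub_eq_add_neg]
  exact hx.mul hl (hy.inv hl)

theorem prod {ι : Type*} (hl0 : l ≠ 0) (hl : u l < 1) (s : Finset ι) {f c : ι → L}
    (h : ∀ i, u.FirstOrder l (f i) (c i)) :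
    u.FirstOrder l (∏ i ∈ s, f i) (∑ i ∈ s, c i) := by
  classical
  induction s using Finset.induction_on with
  | empty => simpa using one hl0
  | insert i s hi ih =>
    rw [Finset.prod_insert hi, Finset.sum_insert hi]
    exact (h i).mul hl ih

theorem pow (hl0 : l ≠ 0) (hl : u l < 1) (hx : u.FirstOrder l x a) (n : ℕ) :
    u.FirstOrder l (x ^ n) (n * a) := by
  simpa using prod hl0 hl (Finset.range n) (fun _ => hx)

/-- If the `p`-th power of `y` is `1 + l d` to first order, then `(y - 1) ^ p` is `l d` to first
order. -/
theorem sub_one_pow_prime {p : ℕ} (hp : p.Prime) (hl : u l < 1) (hup : u p < 1) (hpl : u p ≤ u l)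
    (h : u.FirstOrder l (y ^ p) a) : u ((y - 1) ^ p - l * a) < u l := by
  have hl0 : 0 < u l := zero_le.trans_lt h.2
  have hy : u y = 1 := by
    have := h.map_eq_one hl
    rwa [map_pow, pow_eq_one_iff_of_nonneg zero_le hp.ne_zero] at this
  have hz : u (y - 1) < 1 := by
    refine u.map_sub_lt_one_of_pow_prime hp hup hy.le (map_one u).le ?_
    rw [one_pow]
    exact h.sub_one_lt hl
  obtain ⟨r, hr⟩ := exists_add_pow_prime_eq hp (⟨y - 1, hz.le⟩ : u.integer) (1 : u.integer)
  have hr' : (y - 1 + 1) ^ p = (y - 1) ^ p + 1 ^ p + p * (y - 1) * 1 * r :=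
    congrArg Subtype.val hr
  rw [sub_add_cancel, one_pow] at hr'
  rw [show (y - 1) ^ p - l * a = (y ^ p - (1 + l * a)) - p * ((y - 1) * r) by
    linear_combination -hr']
  refine (u.map_sub _ _).trans_lt (max_lt h.2 ?_)
  rw [map_mul]
  refine (mul_le_mul_left hpl _).trans_lt ?_
  rw [map_mul]
  exact mul_lt_of_lt_one_right hl0 (mul_lt_one_of_lt_of_le hz r.2)

end FirstOrder

section PrimitiveRoot

variable {u} {p : ℕ} {ε : L}

theorem map_primitiveRoot (hp : p.Prime) (hε : IsPrimitiveRoot ε p) : u ε = 1 := by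
  have := congrArg u hε.pow_eq_one
  rwa [map_one, map_pow, pow_eq_one_iff_of_nonneg zero_le hp.ne_zero] at this

theorem map_primitiveRoot_sub_one_lt (hp : p.Prime) (hε : IsPrimitiveRoot ε p) (hup : u p < 1) :
    u (ε - 1) < 1 := by
  refine u.map_sub_lt_one_of_pow_prime hp hup (map_primitiveRoot hp hε).le (map_one u).le ?_
  rw [hε.pow_eq_one, one_pow, sub_self, map_zero]
  exact zero_lt_one

theorem map_primitiveRoot_sub_one_pow_add_lt (hp : p.Prime) (hε : IsPrimitiveRoot ε p)
    (hp0 : (p : L) ≠ 0) (hup : u p < 1) : u ((ε - 1) ^ (p - 1) + p) < u p := by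
  have hl := map_primitiveRoot_sub_one_lt hp hε hup
  have hl0 : ε - 1 ≠ 0 := sub_ne_zero.2 (hε.ne_one hp.one_lt)
  obtain ⟨s, hs⟩ := exists_one_add_pow_prime_eq hp (⟨ε - 1, hl.le⟩ : u.integer)
  have hs' : (ε - 1 + 1) ^ p = (ε - 1) ^ p + 1 + p * ((ε - 1) + (ε - 1) ^ 2 * s) :=
    congrArg Subtype.val hs
  rw [sub_add_cancel, hε.pow_eq_one, ← Nat.sub_add_cancel hp.one_le, pow_succ,
    Nat.sub_add_cancel hp.one_le] at hs'
  have h : (ε - 1) ^ (p - 1) + p = p * (-((ε - 1) * s)) := by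
    apply mul_right_cancel₀ hl0
    linear_combination -hs'
  rw [h, map_mul]
  refine mul_lt_of_lt_one_right (zero_lt_iff.2 (u.ne_zero_iff.2 hp0)) ?_
  rw [map_neg, map_mul]
  exact mul_lt_one_of_lt_of_le hl s.2

theorem map_primitiveRoot_sub_one_pow (hp : p.Prime) (hε : IsPrimitiveRoot ε p)
    (hp0 : (p : L) ≠ 0) (hup : u p < 1) : u (ε - 1) ^ (p - 1) = u p := by
  rw [← map_pow, ← add_sub_cancel_right ((ε - 1) ^ (p - 1)) (p : L)]
  exact u.map_sub_eq_of_lt_right (map_primitiveRoot_sub_one_pow_add_lt hp hε hp0 hup)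

theorem map_prime_le_map_primitiveRoot_sub_one (hp : p.Prime) (hε : IsPrimitiveRoot ε p)
    (hp0 : (p : L) ≠ 0) (hup : u p < 1) : u p ≤ u (ε - 1) := by
  rw [← map_primitiveRoot_sub_one_pow hp hε hp0 hup]
  exact pow_le_of_le_one zero_le (map_primitiveRoot_sub_one_lt hp hε hup).le
    (Nat.sub_ne_zero_of_lt hp.one_lt)

theorem firstOrder_one_add_mul (hp : p.Prime) (hε : IsPrimitiveRoot ε p) (hup : u p < 1)
    {c : L} (hc : u c ≤ 1) (j : ℕ) :
    u.FirstOrder (ε - 1) (1 + c * (ε ^ j - 1)) (c * j) := by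
  have hl := map_primitiveRoot_sub_one_lt hp hε hup
  have hl0 : ε - 1 ≠ 0 := sub_ne_zero.2 (hε.ne_one hp.one_lt)
  refine ⟨?_, ?_⟩
  · rw [map_mul]
    exact mul_le_one₀ hc zero_le (u.map_natCast_le_one j)
  obtain ⟨s, hs⟩ := Polynomial.powAddExpansion (1 : u.integer) ⟨ε - 1, hl.le⟩ j
  have hs' : (1 + (ε - 1)) ^ j = 1 ^ j + j * 1 ^ (j - 1) * (ε - 1) + s * (ε - 1) ^ 2 :=
    congrArg Subtype.val hs
  rw [add_sub_cancel, one_pow, one_pow, mul_one] at hs'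
  rw [show 1 + c * (ε ^ j - 1) - (1 + (ε - 1) * (c * j)) = (ε - 1) * ((ε - 1) * (c * s)) by
    rw [hs']; ring, map_mul]
  refine mul_lt_of_lt_one_right (zero_lt_iff.2 (u.ne_zero_iff.2 hl0)) ?_
  rw [map_mul, map_mul]
  exact mul_lt_one_of_lt_of_le hl (mul_le_one₀ hc zero_le s.2)

end PrimitiveRoot

end Valuation

namespace MonoidHom

/-- The transfer from a normal subgroup, restricted to that subgroup, is a product of
conjugates. -/
theorem exists_transfer_eq_prod_conj {G A : Type*} [Group G] [CommGroup A] {N : Subgroup G}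
    [N.Normal] [N.FiniteIndex] (ϕ : N →* A) :
    letI := N.fintypeQuotientOfFiniteIndex
    ∃ t : G ⧸ N → G, ∀ n : N, transfer ϕ n =
      ∏ q, ϕ ⟨(t q)⁻¹ * n * t q, by
        simpa using ‹N.Normal›.conj_mem n n.2 (t q)⁻¹⟩ := by
  let _ := N.fintypeQuotientOfFiniteIndex
  let S : N.LeftTransversal := default
  refine ⟨fun q => S.2.leftQuotientEquiv q, fun n => ?_⟩
  rw [transfer_def ϕ S]
  unfold Subgroup.leftTransversals.diff
  refine Finset.prod_congr rfl fun q _ => ?_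
  congr 2
  have hq : (n : G)⁻¹ • q = q := by
    induction q using QuotientGroup.induction_on with
    | H g =>
      rw [MulAction.Quotient.smul_coe, QuotientGroup.eq, smul_eq_mul]
      simpa [mul_assoc] using ‹N.Normal›.conj_mem n n.2 g⁻¹
  rw [Subgroup.smul_apply_eq_smul_apply_inv_smul, hq, smul_eq_mul, mul_assoc]

end MonoidHom

theorem Valuation.HasExtension.map_natCast_lt_one {K L Γ₀ Γ : Type*} [Field K] [Field L] [Algebra K L]
    [LinearOrderedCommGroupWithZero Γ₀] [LinearOrderedCommGroupWithZero Γ] {v : Valuation K Γ₀}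
    {n : ℕ} (hn : v n < 1) (u : Valuation L Γ) [v.HasExtension u] : u (n : L) < 1 := by
  rw [← map_natCast (algebraMap K L),
    Valuation.HasExtension.val_map_lt_one_iff v]
  exact hn

section Cyclotomic

variable {K Γ₀ Γ : Type*} [Field K] [LinearOrderedCommGroupWithZero Γ₀]
  [LinearOrderedCommGroupWithZero Γ] {p : ℕ} [hp : Fact p.Prime] {v : Valuation K Γ₀}
  {ε : SeparableClosure K}

theorem coprime_card_quotient_ker_comp_autToPow (hε : IsPrimitiveRoot ε p) {H : Type*} [Group H]
    (f : H →* Gal(SeparableClosure K/K)) :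
    (Nat.card (H ⧸ ((hε.autToPow K).comp f).ker)).Coprime p := by
  rw [Nat.card_congr (QuotientGroup.quotientKerEquivRange _).toEquiv]
  have h1 := ((hε.autToPow K).comp f).range.card_subgroup_dvd_card
  rw [Nat.card_eq_fintype_card (α := (ZMod p)ˣ), ZMod.card_units] at h1
  refine Nat.Coprime.coprime_dvd_left h1 ?_
  exact Nat.Coprime.symm (hp.1.coprime_iff_not_dvd.2 fun h =>
    (Nat.sub_lt hp.1.pos one_pos).not_ge (Nat.le_of_dvd (Nat.sub_pos_of_lt hp.1.one_lt) h))

theorem autToPow_eq_one_iff (hε : IsPrimitiveRoot ε p) (g : Gal(SeparableClosure K/K)) :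
    hε.autToPow K g = 1 ↔ g ε = ε := by
  constructor
  · intro h
    have h1 := hε.autToPow_spec K g
    have : Fact (1 < p) := ⟨hp.1.one_lt⟩
    rw [h, Units.val_one, ZMod.val_one, pow_one] at h1
    exact h1.symm
  · intro h
    ext
    apply ZMod.val_injective p
    have h1 := hε.autToPow_spec K g
    have : Fact (1 < p) := ⟨hp.1.one_lt⟩
    rw [Units.val_one, ZMod.val_one]
    refine hε.pow_inj (ZMod.val_lt _) hp.1.one_lt ?_
    rw [h1, h, pow_one]

theorem map_rootOfUnity_eq_pow_autToPow (hε : IsPrimitiveRoot ε p)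
    (g : Gal(SeparableClosure K/K)) {ζ : SeparableClosure K} (hζ : ζ ^ p = 1) :
    g ζ = ζ ^ (hε.autToPow K g : ZMod p).val := by
  obtain ⟨i, -, rfl⟩ := hε.eq_pow_of_pow_eq_one hζ
  rw [map_pow, ← hε.autToPow_spec K g, ← pow_mul, ← pow_mul, mul_comm]

theorem hasExtension_comap_galois (u : Valuation (SeparableClosure K) Γ) [hu : v.HasExtension u]
    (g : Gal(SeparableClosure K/K)) :
    v.HasExtension (u.comap (g : SeparableClosure K →+* SeparableClosure K)) := by
  refine ⟨hu.val_isEquiv_comap.trans ?_⟩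
  rw [Valuation.isEquiv_iff_val_le_one]
  intro x
  simp

/-- A `p`-th root of a residue class of `K` that is represented over `K(ε)` is represented
over `K`, and similarly over the fixed field of a subgroup `H`. -/
theorem exists_fixed_of_pow_residue (hε : IsPrimitiveRoot ε p) (hvp : v p < 1)
    (H : Subgroup Gal(SeparableClosure K/K)) {w : SeparableClosure K} {a : K} (ha : v a ≤ 1)
    (hfix : ∀ g ∈ H, g ε = ε → g w = w)
    (hw : ∀ u : Valuation (SeparableClosure K) Γ, v.HasExtension u →
      u (w ^ p - algebraMap K _ a) < 1) :
    ∃ θ : SeparableClosure K, (∀ g ∈ H, g θ = θ) ∧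
      ∀ u : Valuation (SeparableClosure K) Γ, v.HasExtension u →
        u (θ ^ p - algebraMap K _ a) < 1 := by
  let ω := (hε.autToPow K).comp H.subtype
  let _ : Fintype (H ⧸ ω.ker) := Fintype.ofFinite _
  let f (q : H ⧸ ω.ker) : SeparableClosure K := (q.out : Gal(SeparableClosure K/K)) w
  have hf (h : H) : f h = (h : Gal(SeparableClosure K/K)) w := by
    obtain ⟨n, hn⟩ := QuotientGroup.mk_out_eq_mul ω.ker h
    have h1 : (n : H).1 ε = ε := (autToPow_eq_one_iff hε _).1 n.2
    simp only [f]
    rw [hn, Subgroup.coe_mul, AlgEquiv.mul_apply, hfix _ (n : H).2 h1]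
  set m := Nat.card (H ⧸ ω.ker)
  have hm : m.Coprime p := coprime_card_quotient_ker_comp_autToPow hε H.subtype
  refine ⟨(m : SeparableClosure K)⁻¹ * ∑ q, f q, fun g hg => ?_, fun u hu => ?_⟩
  · rw [map_mul, map_inv₀, map_natCast, map_sum]
    congr 1
    refine Fintype.sum_equiv (MulAction.toPerm (⟨g, hg⟩ : H)) _ _ fun q => ?_
    induction q using QuotientGroup.induction_on with
    | H h =>
      rw [MulAction.toPerm_apply, hf]
      exact (hf (⟨g, hg⟩ * h)).symm
  · have hup := Valuation.HasExtension.map_natCast_lt_one hvp u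
    have hum := u.map_natCast_eq_one_of_coprime hup hm
    have hm0 : (m : SeparableClosure K) ≠ 0 := by
      intro h0; rw [h0, map_zero] at hum; exact zero_ne_one hum
    have hua : u (algebraMap K _ a) ≤ 1 := (Valuation.HasExtension.val_map_le_one_iff v u a).2 ha
    have hint {x : SeparableClosure K} (hx : u (x ^ p - algebraMap K _ a) < 1) : u x ≤ 1 := by
      have := u.map_le_one_of_sub_lt_one hua hx
      rwa [map_pow, pow_le_one_iff hp.1.ne_zero] at this
    have hq (q) : u (f q - w) < 1 := by
      have h1 := hw _ (hasExtension_comap_galois (v := v) u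
        (q.out : Gal(SeparableClosure K/K)))
      have h2 : u (f q ^ p - algebraMap K _ a) < 1 := by simpa [f] using h1
      refine u.map_sub_lt_one_of_pow_prime hp.1 hup (hint h2) (hint (hw u hu)) ?_
      rw [← sub_sub_sub_cancel_right _ _ (algebraMap K _ a)]
      exact (u.map_sub _ _).trans_lt (max_lt h2 (hw u hu))
    have hθ : u ((m : SeparableClosure K)⁻¹ * ∑ q, f q - w) < 1 := by
      have : (m : SeparableClosure K)⁻¹ * ∑ q, f q - w =
          (m : SeparableClosure K)⁻¹ * ∑ q, (f q - w) := by
        rw [Finset.sum_sub_distrib, Finset.sum_const, Finset.card_univ, ← Nat.card_eq_fintype_card,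
          nsmul_eq_mul]
        change _ = _ * (_ - (m : SeparableClosure K) * w)
        field_simp
      rw [this, map_mul, map_inv₀, hum, inv_one, one_mul]
      exact u.map_sum_lt one_ne_zero fun q _ => hq q
    rw [← sub_add_sub_cancel _ (w ^ p)]
    exact u.map_add_lt (u.map_sub_pow_lt_one (u.map_le_one_of_sub_lt_one (hint (hw u hu)) hθ)
      (hint (hw u hu)) hθ p) (hw u hu)

/-- The Kummer cocycle of a `p`-th root, as a character of the stabilizer of the roots of unity. -/
theorem exists_kummer_character (hε : IsPrimitiveRoot ε p) {Y : SeparableClosure K} (hY : Y ≠ 0)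
    (hfix : ∀ g ∈ (hε.autToPow K).ker, g (Y ^ p) = Y ^ p) :
    ∃ χ : (hε.autToPow K).ker →* rootsOfUnity p (SeparableClosure K),
      ∀ n : (hε.autToPow K).ker, (n : Gal(SeparableClosure K/K)) Y =
        ((χ n : (SeparableClosure K)ˣ) : SeparableClosure K) * Y := by
  have key (n : (hε.autToPow K).ker) : ∃ ζ : rootsOfUnity p (SeparableClosure K),
      (n : Gal(SeparableClosure K/K)) Y =
        ((ζ : (SeparableClosure K)ˣ) : SeparableClosure K) * Y := by
    have h1 := hfix n n.2
    refine ⟨rootsOfUnity.mkOfPowEq ((n : Gal(SeparableClosure K/K)) Y / Y) ?_, ?_⟩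
    · rw [div_pow, ← map_pow, h1, div_self (pow_ne_zero _ hY)]
    · rw [rootsOfUnity.coe_mkOfPowEq, div_mul_cancel₀ _ hY]
  choose χ hχ using key
  refine ⟨MonoidHom.mk' χ fun n n' => ?_, hχ⟩
  have h1 := hχ (n * n')
  have h2 : (n : Gal(SeparableClosure K/K)) ((χ n' : (SeparableClosure K)ˣ) : SeparableClosure K) =
      ((χ n' : (SeparableClosure K)ˣ) : SeparableClosure K) := by
    have : Fact (1 < p) := ⟨hp.1.one_lt⟩
    rw [map_rootOfUnity_eq_pow_autToPow hε _ ((mem_rootsOfUnity' _ _).1 (χ n').2), MonoidHom.mem_ker.1 n.2,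
      Units.val_one, ZMod.val_one, pow_one]
  rw [Subgroup.coe_mul, AlgEquiv.mul_apply, hχ n', map_mul, hχ n, h2] at h1
  apply Subtype.ext
  apply Units.ext
  apply mul_right_cancel₀ hY
  rw [← h1]
  push_cast
  ring

end Cyclotomic

theorem natCast_ne_zero_of_algebra {K L : Type*} [Field K] [Field L] [Algebra K L] {n : ℕ}
    (hn : (n : K) ≠ 0) : (n : L) ≠ 0 := by
  rw [← map_natCast (algebraMap K L)]
  exact (map_ne_zero _).2 hn

theorem exists_primitiveRoot_separableClosure {K : Type*} [Field K] {n : ℕ} (hn : (n : K) ≠ 0) :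
    ∃ ε : SeparableClosure K, IsPrimitiveRoot ε n := by
  have : NeZero (n : SeparableClosure K) := ⟨natCast_ne_zero_of_algebra hn⟩
  exact HasEnoughRootsOfUnity.exists_primitiveRoot _ n

section Kummer

variable {K Γ₀ Γ : Type*} [Field K] [LinearOrderedCommGroupWithZero Γ₀]
  [LinearOrderedCommGroupWithZero Γ] {p : ℕ} [hp : Fact p.Prime] {v : Valuation K Γ₀}
  {ε : SeparableClosure K}

/-- The twisted product of conjugates of `Y`: the transfer of the Kummer character of `Y ^ p` is,
on the stabilizer of the roots of unity, the Kummer character of an explicit element. -/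
theorem exists_transfer_kummer (hε : IsPrimitiveRoot ε p) {Y : SeparableClosure K} (hY : Y ≠ 0)
    (hfix : ∀ g ∈ (hε.autToPow K).ker, g (Y ^ p) = Y ^ p) :
    ∃ (T : Gal(SeparableClosure K/K) →* rootsOfUnity p (SeparableClosure K))
      (t : Gal(SeparableClosure K/K) ⧸ (hε.autToPow K).ker → Gal(SeparableClosure K/K))
      (j : Gal(SeparableClosure K/K) ⧸ (hε.autToPow K).ker → ℕ),
      letI := (hε.autToPow K).ker.fintypeQuotientOfFiniteIndex
      (∀ q, ((j q : ℕ) : ZMod p) * (hε.autToPow K (t q) : ZMod p) = 1) ∧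
      ∀ n ∈ (hε.autToPow K).ker, n (∏ q, (t q Y) ^ j q) =
        ((T n : (SeparableClosure K)ˣ) : SeparableClosure K) * ∏ q, (t q Y) ^ j q := by
  let _ := (hε.autToPow K).ker.fintypeQuotientOfFiniteIndex
  obtain ⟨χ, hχ⟩ := exists_kummer_character hε hY hfix
  obtain ⟨t, ht⟩ := MonoidHom.exists_transfer_eq_prod_conj χ
  let j (q : Gal(SeparableClosure K/K) ⧸ (hε.autToPow K).ker) : ℕ :=
    (((hε.autToPow K (t q))⁻¹ : (ZMod p)ˣ) : ZMod p).val
  have hj (q) : ((j q : ℕ) : ZMod p) * (hε.autToPow K (t q) : ZMod p) = 1 := by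
    rw [ZMod.natCast_zmod_val, Units.inv_mul]
  refine ⟨MonoidHom.transfer χ, t, j, hj, fun n hn => ?_⟩
  rw [ht ⟨n, hn⟩]
  push_cast
  rw [map_prod, ← Finset.prod_mul_distrib]
  refine Finset.prod_congr rfl fun q _ => ?_
  set n' : (hε.autToPow K).ker := ⟨(t q)⁻¹ * n * t q, by
    simpa using (MonoidHom.normal_ker (hε.autToPow K)).conj_mem n hn (t q)⁻¹⟩ with hn'
  have h1 : n (t q Y) = t q ((n' : Gal(SeparableClosure K/K)) Y) := by
    rw [hn', ← AlgEquiv.mul_apply, ← AlgEquiv.mul_apply]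
    congr 1
    group
  have hroot : ((χ n' : (SeparableClosure K)ˣ) : SeparableClosure K) ^ p = 1 :=
    (mem_rootsOfUnity' _ _).1 (χ n').2
  rw [map_pow, h1, hχ n', map_mul, mul_pow, map_rootOfUnity_eq_pow_autToPow hε _ hroot, ← pow_mul]
  congr 1
  have hmod : (hε.autToPow K (t q) : ZMod p).val * j q ≡ 1 [MOD p] := by
    rw [← ZMod.natCast_eq_natCast_iff]
    push_cast
    rw [ZMod.natCast_zmod_val, mul_comm, hj]
  have := pow_eq_pow_of_modEq hmod hroot
  rw [this, pow_one]

/-- For every integral `c` in `K` there is a `K`-rational character of order dividing `p` which,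
over `K(ε)`, is the Kummer character of an element that is `1 + (ε - 1) c` to first order. -/
theorem exists_firstOrder_hom (hε : IsPrimitiveRoot ε p) (hp0 : (p : K) ≠ 0) (hvp : v p < 1)
    {c : K} (hc : v c ≤ 1) :
    ∃ (T : Gal(SeparableClosure K/K) →* rootsOfUnity p (SeparableClosure K))
      (y : SeparableClosure K), IsOpen (T.ker : Set Gal(SeparableClosure K/K)) ∧ y ≠ 0 ∧
      (∀ g : Gal(SeparableClosure K/K), g ε = ε →
        g y = ((T g : (SeparableClosure K)ˣ) : SeparableClosure K) * y) ∧
      ∀ u : Valuation (SeparableClosure K) Γ, v.HasExtension u →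
        u.FirstOrder (ε - 1) (y ^ p) (algebraMap K _ c) := by
  let _ := (hε.autToPow K).ker.fintypeQuotientOfFiniteIndex
  have hp0' := natCast_ne_zero_of_algebra (L := SeparableClosure K) hp0
  have : NeZero (p : SeparableClosure K) := ⟨hp0'⟩
  have hl0 : ε - 1 ≠ 0 := sub_ne_zero.2 (hε.ne_one hp.1.one_lt)
  set m := Nat.card (Gal(SeparableClosure K/K) ⧸ (hε.autToPow K).ker)
  have hm : m.Coprime p := coprime_card_quotient_ker_comp_autToPow hε (MonoidHom.id _)
  have hvm : v (m : K) = 1 := v.map_natCast_eq_one_of_coprime hvp hm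
  have hm0 : (m : K) ≠ 0 := by
    intro h0; rw [h0, map_zero] at hvm; exact zero_ne_one hvm
  have hd : v (c / m) ≤ 1 := by rwa [map_div₀, hvm, div_one]
  set d : SeparableClosure K := algebraMap K _ (c / m)
  obtain ⟨Y, hYp⟩ := IsSepClosed.exists_pow_nat_eq (1 + d * (ε - 1)) p
  have hY : Y ≠ 0 := by
    obtain ⟨U, hU⟩ := v.exists_hasExtension (Ω := SeparableClosure K)
    have hup := Valuation.HasExtension.map_natCast_lt_one hvp U.valuation
    have hl := Valuation.map_primitiveRoot_sub_one_lt hp.1 hε hup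
    have h1 := Valuation.firstOrder_one_add_mul hp.1 hε hup
      ((Valuation.HasExtension.val_map_le_one_iff v U.valuation _).2 hd) 1
    rw [pow_one] at h1
    have h2 := h1.map_eq_one hl
    rintro rfl
    rw [← hYp, zero_pow hp.1.ne_zero, map_zero] at h2
    exact zero_ne_one h2
  have hconj (g : Gal(SeparableClosure K/K)) :
      (g Y) ^ p = 1 + d * (ε ^ (hε.autToPow K g : ZMod p).val - 1) := by
    rw [← map_pow, hYp, hε.autToPow_spec K]
    simp [d]
  obtain ⟨T, t, j, hj, hT⟩ := exists_transfer_kummer hε hY fun g hg => by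
    rw [map_pow, hconj, hYp, hε.autToPow_spec K, (autToPow_eq_one_iff hε g).1 hg]
  set y := ∏ q, (t q Y) ^ j q
  have hy : y ≠ 0 := Finset.prod_ne_zero_iff.2 fun q _ => pow_ne_zero _ (by simpa using hY)
  have hTy (g : Gal(SeparableClosure K/K)) (hg : g ε = ε) :
      g y = ((T g : (SeparableClosure K)ˣ) : SeparableClosure K) * y :=
    hT g ((autToPow_eq_one_iff hε g).2 hg)
  refine ⟨T, y, ?_, hy, hTy, fun u hu => ?_⟩
  · refine Subgroup.isOpen_mono (H₁ := MulAction.stabilizer _ ε ⊓ MulAction.stabilizer _ y) ?_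
      ((stabilizer_isOpen_of_isIntegral (K := K) ε).inter
        (stabilizer_isOpen_of_isIntegral (K := K) y))
    intro g hg
    obtain ⟨h1, h2⟩ := Subgroup.mem_inf.1 hg
    have h3 : g y = y := h2
    have h4 := hTy g h1
    rw [h3] at h4
    rw [MonoidHom.mem_ker]
    apply Subtype.ext
    apply Units.ext
    exact mul_right_cancel₀ hy (h4.symm.trans (one_mul y).symm)
  · have hup := Valuation.HasExtension.map_natCast_lt_one hvp u
    have hl := Valuation.map_primitiveRoot_sub_one_lt hp.1 hε hup
    have hdu : u d ≤ 1 := (Valuation.HasExtension.val_map_le_one_iff v u _).2 hd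
    have hfac (q) : u.FirstOrder (ε - 1) (((t q Y) ^ j q) ^ p) d := by
      rw [← pow_mul, mul_comm, pow_mul, hconj]
      have h1 := Valuation.firstOrder_one_add_mul hp.1 hε hup hdu
        (hε.autToPow K (t q) : ZMod p).val
      refine (h1.pow hl0 hl (j q)).congr ?_
      have hdvd : (p : ℤ) ∣ 1 - j q * (hε.autToPow K (t q) : ZMod p).val := by
        rw [← ZMod.intCast_zmod_eq_zero_iff_dvd]
        push_cast
        rw [ZMod.natCast_zmod_val, hj, sub_self]
      obtain ⟨k, hk⟩ := hdvd
      have hk' : (1 - j q * (hε.autToPow K (t q) : ZMod p).val : SeparableClosure K) = p * k := by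
        exact_mod_cast congrArg (Int.cast (R := SeparableClosure K)) hk
      rw [show d - j q * (d * (hε.autToPow K (t q) : ZMod p).val) = p * (k * d) by
        linear_combination d * hk', map_mul]
      refine mul_lt_one_of_lt_of_le hup ?_
      rw [map_mul]
      exact mul_le_one₀ (intCast_mem u.integer k) zero_le hdu
    have h2 := Valuation.FirstOrder.prod hl0 hl Finset.univ hfac
    rw [Finset.prod_pow, Finset.sum_const, Finset.card_univ, ← Nat.card_eq_fintype_card,
      nsmul_eq_mul] at h2
    have h3 : (m : SeparableClosure K) * d = algebraMap K _ c := by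
      rw [← map_natCast (algebraMap K (SeparableClosure K)), ← map_mul, mul_div_cancel₀ _ hm0]
    rwa [h3] at h2

theorem pRank_eq_top_of_ne_zero (hp0 : (p : K) ≠ 0) (hvp : v p < 1)
    (himp : ¬ PerfectField (IsLocalRing.ResidueField v.valuationSubring))
    {a : K} (ha : ∀ x : K, ¬ v (x ^ p - a) < 1) (ha1 : v a = 1) : pRank p K = ⊤ := by
  obtain ⟨ε, hε⟩ := exists_primitiveRoot_separableClosure hp0
  obtain ⟨U, hU⟩ := v.exists_hasExtension (Ω := SeparableClosure K)
  have hp0' := natCast_ne_zero_of_algebra (L := SeparableClosure K) hp0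
  have hl0 : ε - 1 ≠ 0 := sub_ne_zero.2 (hε.ne_one hp.1.one_lt)
  have := v.infinite_residueField himp
  choose r hr using IsLocalRing.residue_surjective (R := v.valuationSubring)
  by_contra hrank
  have key (b : K) (hb : v b = 1) : ∃ (e : K) (z : SeparableClosure K), v e = 1 ∧
      (∀ g : Gal(SeparableClosure K/K), g ε = ε → g z = z) ∧
      ∀ u : Valuation (SeparableClosure K) U.ValueGroup, v.HasExtension u →
        u (z ^ p / (ε - 1) - algebraMap K _ (b * e ^ p)) < 1 := by
    have hint (s) : v (b * (r s : K) ^ p) ≤ 1 := by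
      rw [map_mul, hb, one_mul, map_pow]
      exact pow_le_one₀ zero_le (r s).2
    choose T y hT hy0 hTy hy using fun s => exists_firstOrder_hom (Γ := U.ValueGroup)
      hε hp0 hvp (hint s)
    have hninj : ¬ Function.Injective T := fun hinj =>
      hrank (pRank_eq_top_of_injective hp.1 hε.card_rootsOfUnity T hT hinj)
    simp only [Function.Injective, not_forall] at hninj
    obtain ⟨s, s', heq, hne⟩ := hninj
    have he : v ((r s : K) - r s') = 1 := by
      refine le_antisymm (r s - r s').2 (not_lt.1 fun h => hne ?_)
      rw [← hr s, ← hr s', Valuation.residue_eq_iff]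
      exact h
    refine ⟨r s - r s', y s / y s' - 1, he, fun g hg => ?_, fun u hu => ?_⟩
    · rw [map_sub, map_one, map_div₀, hTy s g hg, hTy s' g hg, heq]
      rw [mul_div_mul_left _ _ (Units.ne_zero _)]
    · have hup := Valuation.HasExtension.map_natCast_lt_one hvp u
      have hl := Valuation.map_primitiveRoot_sub_one_lt hp.1 hε hup
      have h1 := ((hy s u hu).div hl (hy s' u hu)).congr
        (b := algebraMap K _ (b * ((r s : K) - r s') ^ p)) (by
          rw [← map_sub, ← map_sub, Valuation.HasExtension.val_map_lt_one_iff v u, ← mul_sub,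
            ← mul_sub, map_mul, hb, one_mul]
          exact v.map_sub_pow_prime_sub_lt_one hp.1 hvp (r s).2 (r s').2)
      rw [← div_pow] at h1
      have h2 := h1.sub_one_pow_prime hp.1 hl hup
        (Valuation.map_prime_le_map_primitiveRoot_sub_one hp.1 hε hp0' hup)
      rw [show (y s / y s' - 1) ^ p / (ε - 1) - algebraMap K _ (b * ((r s : K) - r s') ^ p) =
        ((y s / y s' - 1) ^ p - (ε - 1) * algebraMap K _ (b * ((r s : K) - r s') ^ p)) / (ε - 1) by
          field_simp, map_div₀]
      exact (div_lt_one₀ (zero_lt_iff.2 (u.ne_zero_iff.2 hl0))).2 h2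
  obtain ⟨e₁, z₁, he₁, hfix₁, hz₁⟩ := key 1 (map_one v)
  obtain ⟨e₂, z₂, he₂, hfix₂, hz₂⟩ := key a ha1
  obtain ⟨θ, hθ, hθu⟩ := exists_fixed_of_pow_residue (Γ := U.ValueGroup) (v := v) hε hvp ⊤ ha1.le
    (w := z₂ * algebraMap K _ e₁ / (z₁ * algebraMap K _ e₂)) (fun g _ hg => by
      rw [map_div₀, map_mul, map_mul, hfix₁ g hg, hfix₂ g hg, AlgEquiv.commutes, AlgEquiv.commutes])
    fun u hu => by
      have hu1 (x : K) (hx : v x = 1) : u (algebraMap K _ x) = 1 :=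
        (Valuation.HasExtension.val_map_eq_one_iff v u x).2 hx
      have h1 := hz₁ u hu
      have h2 := hz₂ u hu
      rw [one_mul] at h1
      set D₁ := z₁ ^ p / (ε - 1) with hD₁
      set D₂ := z₂ ^ p / (ε - 1) with hD₂
      have hE₁ := hu1 e₁ he₁
      have hE₂ := hu1 e₂ he₂
      have hA := hu1 a ha1
      rw [map_pow] at h1
      rw [map_mul, map_pow] at h2
      set E₁ := algebraMap K (SeparableClosure K) e₁
      set E₂ := algebraMap K (SeparableClosure K) e₂
      set A := algebraMap K (SeparableClosure K) a
      have hD1 : u D₁ = 1 := u.map_eq_of_sub_lt_one (by rw [map_pow, hE₁, one_pow]) h1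
      have hD10 : D₁ ≠ 0 := by intro h0; rw [h0, map_zero] at hD1; exact zero_ne_one hD1
      have hE20 : E₂ ≠ 0 := by intro h0; rw [h0, map_zero] at hE₂; exact zero_ne_one hE₂
      have hz1 : z₁ ^ p = D₁ * (ε - 1) := by rw [hD₁]; field_simp
      have hz2 : z₂ ^ p = D₂ * (ε - 1) := by rw [hD₂]; field_simp
      have : (z₂ * E₁ / (z₁ * E₂)) ^ p - A =
          ((D₂ - A * E₂ ^ p) * E₁ ^ p - A * E₂ ^ p * (D₁ - E₁ ^ p)) / (D₁ * E₂ ^ p) := by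
        rw [div_pow, mul_pow, mul_pow, hz1, hz2]
        field_simp
        ring
      rw [this, map_div₀, map_mul u D₁, hD1, map_pow, hE₂, one_pow, one_mul, div_one]
      refine (u.map_sub _ _).trans_lt (max_lt ?_ ?_)
      · rw [map_mul, map_pow, hE₁, one_pow, mul_one]
        exact h2
      · rw [map_mul, map_mul, map_pow, hE₂, hA, one_pow, one_mul, one_mul]
        exact h1
  obtain ⟨x, rfl⟩ := (InfiniteGalois.mem_range_algebraMap_iff_fixed θ).2 fun g =>
    hθ g (Subgroup.mem_top g)
  refine ha x ?_
  have := hθu U.valuation hU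
  rwa [← map_pow, ← map_sub, Valuation.HasExtension.val_map_lt_one_iff v] at this

theorem exists_purelyInseparable_of_ne_zero (hp0 : (p : K) ≠ 0) (hvp : v p < 1)
    (hchar : CharP (IsLocalRing.ResidueField v.valuationSubring) p)
    {a : K} (ha : ∀ x : K, ¬ v (x ^ p - a) < 1) (ha1 : v a = 1)
    {x : K} (hx0 : x ≠ 0) (hx : v p = v x ^ p) :
    ∃ (Λ : IntermediateField K (maximalPExtension p K)) (w : ValuationSubring Λ)
          (_ : v.HasExtension w.valuation),
          Module.finrank K Λ = p ∧
          Module.finrank (IsLocalRing.ResidueField v.valuationSubring)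
            (IsLocalRing.ResidueField w.valuation.valuationSubring) = p ∧
          IsPurelyInseparable (IsLocalRing.ResidueField v.valuationSubring)
            (IsLocalRing.ResidueField w.valuation.valuationSubring) := by
  obtain ⟨ε, hε⟩ := exists_primitiveRoot_separableClosure hp0
  obtain ⟨U, hU⟩ := v.exists_hasExtension (Ω := SeparableClosure K)
  have hp0' := natCast_ne_zero_of_algebra (L := SeparableClosure K) hp0
  have hl0 : ε - 1 ≠ 0 := sub_ne_zero.2 (hε.ne_one hp.1.one_lt)
  have hvx0 : v x ^ p ≠ 0 := pow_ne_zero _ (v.ne_zero_iff.2 hx0)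
  have hc : v (-(a * p) / x ^ p) ≤ 1 := by
    rw [map_div₀, Valuation.map_neg, map_mul, ha1, hx, one_mul, map_pow, div_self hvx0]
  obtain ⟨T, y, hT, -, hTy, hy⟩ := exists_firstOrder_hom (Γ := U.ValueGroup) hε hp0 hvp hc
  set X : SeparableClosure K := algebraMap K _ x with hX
  have hX0 : X ≠ 0 := by simpa [hX] using hx0
  obtain ⟨θ, hθ, hθu⟩ := exists_fixed_of_pow_residue (Γ := U.ValueGroup) (v := v) hε hvp T.ker
    ha1.le (w := (y - 1) * X / (ε - 1)) (fun g hgT hg => by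
      rw [map_div₀, map_mul, map_sub, map_sub, map_one, hg, hTy g hg, MonoidHom.mem_ker.1 hgT, hX,
        AlgEquiv.commutes]
      simp)
    fun u hu => by
      have hup := Valuation.HasExtension.map_natCast_lt_one hvp u
      have hl := Valuation.map_primitiveRoot_sub_one_lt hp.1 hε hup
      have hul0 := u.ne_zero_iff.2 hl0
      have hA : u (algebraMap K _ a) = 1 :=
        (Valuation.HasExtension.val_map_eq_one_iff v u a).2 ha1
      have huX : u (X ^ p) = u (ε - 1) ^ (p - 1) := by
        rw [Valuation.map_primitiveRoot_sub_one_pow hp.1 hε hp0' hup,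
          ← map_natCast (algebraMap K (SeparableClosure K)), hX, ← map_pow,
          Valuation.HasExtension.val_map_eq_iff v u, hx, map_pow]
      have h1 := (hy u hu).sub_one_pow_prime hp.1 hl hup
        (Valuation.map_prime_le_map_primitiveRoot_sub_one hp.1 hε hp0' hup)
      have h2 := Valuation.map_primitiveRoot_sub_one_pow_add_lt (u := u) hp.1 hε hp0' hup
      have hC : algebraMap K (SeparableClosure K) (-(a * p) / x ^ p) =
          -(algebraMap K _ a * p) / X ^ p := by simp [hX]
      rw [hC] at h1
      set A := algebraMap K (SeparableClosure K) a
      set l := ε - 1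
      have hlp : l ^ p = l * l ^ (p - 1) := by
        rw [← pow_succ', Nat.sub_add_cancel hp.1.one_le]
      have : ((y - 1) * X / l) ^ p - A =
          ((y - 1) ^ p - l * (-(A * p) / X ^ p)) / l * (X ^ p / l ^ (p - 1)) -
            A * ((l ^ (p - 1) + p) / l ^ (p - 1)) := by
        rw [div_pow, mul_pow, hlp]
        field_simp
        ring
      rw [this]
      refine (u.map_sub _ _).trans_lt (max_lt ?_ ?_)
      · rw [map_mul, map_div₀ u (X ^ p), huX, map_pow u l, div_self (pow_ne_zero _ hul0), mul_one,
          map_div₀]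
        exact (div_lt_one₀ (zero_lt_iff.2 hul0)).2 h1
      · rw [map_mul, hA, one_mul, map_div₀, map_pow,
          Valuation.map_primitiveRoot_sub_one_pow hp.1 hε hp0' hup]
        exact (div_lt_one₀ (zero_lt_iff.2 (u.ne_zero_iff.2 hp0'))).2 h2
  exact exists_purelyInseparable_of_hom hp.1 hchar hε.card_rootsOfUnity T hT U ha ha1 hθ
    (hθu U.valuation hU)

end Kummer

theorem lemma4p1 {K Γ₀ : Type*} [Field K] [LinearOrderedCommGroupWithZero Γ₀]
    (v : Valuation K Γ₀) (hv : v.IsNontrivial) (p : ℕ) (hp : p.Prime)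
    (hens : v.IsPHenselian p)
    (hchar : CharP (IsLocalRing.ResidueField v.valuationSubring) p)
    (himp : ¬ PerfectField (IsLocalRing.ResidueField v.valuationSubring)) :
    pRank p K = ⊤ ∧
      ((CharP K p ∨ ∃ x : K, x ≠ 0 ∧ v (p : K) = v x ^ p) →
        ∃ (Λ : IntermediateField K (maximalPExtension p K)) (w : ValuationSubring Λ)
          (_ : v.HasExtension w.valuation),
          Module.finrank K Λ = p ∧
          Module.finrank (IsLocalRing.ResidueField v.valuationSubring)
            (IsLocalRing.ResidueField w.valuation.valuationSubring) = p ∧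
          IsPurelyInseparable (IsLocalRing.ResidueField v.valuationSubring)
            (IsLocalRing.ResidueField w.valuation.valuationSubring)) := by
  have : Fact p.Prime := ⟨hp⟩
  obtain ⟨a, ha1, ha⟩ := v.exists_not_pow_residue hp hchar himp
  by_cases hp0 : (p : K) = 0
  · have : CharP K p := (CharP.charP_iff_prime_eq_zero hp).2 hp0
    exact ⟨pRank_eq_top_of_charP hv ha ha1, fun _ =>
      exists_purelyInseparable_of_charP hv hchar ha ha1⟩
  · have hvp := v.natCast_lt_one_of_charP_residueField hchar
    refine ⟨pRank_eq_top_of_ne_zero hp0 hvp himp ha ha1, ?_⟩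
    rintro (h | ⟨x, hx0, hx⟩)
    · exact absurd (CharP.cast_eq_zero K p) hp0
    · exact exists_purelyInseparable_of_ne_zero hp0 hvp hchar ha ha1 hx0 hx
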